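/- Let $n\in\mathbb N$ and let $V:\mathbb R^n\to\mathbb C$ be measurable with $\operatorname{Re}V(x)\ge 0$ for all $x$ and $\operatorname{Re}V(x)\to\infty$ as $|x|\to\infty$. Let $\mathcal H_{00}=-\Delta+\operatorname{Re}V$ be the operator in $L^2(\mathbb R^n)$ associated with the closed form $\int\nabla u\cdot\overline{\nabla v}\,dx+\int \operatorname{Re}V\,u\,\overline v\,dx$ on $\{u\in H^1(\mathbb R^n): (\operatorname{Re}V)^{1/2}u\in L^2(\mathbb R^n)\}$, and let $i\operatorname{Im}V$ also denote the multiplication operator with domain $\{u\in L^2(\mathbb R^n):(\operatorname{Im}V)u\in L^2(\mathbb R^n)\}$. Suppose that $i\operatorname{Im}V$ is relatively compact with respect to $\mathcal H_{00}$, that is: $\mathcal H_{00}$ is densely defined with non-empty resolvent set, $\mathcal D(\mathcal H_{00})\subseteq\mathcal D(i\operatorname{Im}V)$, and $(i\operatorname{Im}V)(z-\mathcal H_{00})^{-1}$ is a compact operator on $L^2(\mathbb R^n)$ for some $z\in\rho(\mathcal H_{00})$. Then the (in general non-self-adjoint) Schrödinger operator $\mathcal H_0=-\Delta+V$, defined as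 the operator sum $\mathcal H_{00}+i\operatorname{Im}V$, with domain $\mathcal D(\mathcal H_{00})\cap\mathcal D(i\operatorname{Im}V)$, has purely discrete spectrum. That is, its essential spectrum $\bigcap\{\sigma(\mathcal H_0+K): K \text{ a compact operator on } L^2(\mathbb R^n)\}$ is empty, and every point $\lambda$ of $\sigma(\mathcal H_0)$ is an isolated point of $\sigma(\mathcal H_0)$ and an eigenvalue of finite algebraic multiplicity, i.e. $\dim\bigcup_{k}\ker(\mathcal H_0-\lambda)^k<\infty$. -/

import Mathlib

open MeasureTheory Filter Topology
open scoped ContDiff InnerProductSpace ComplexConjugate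

noncomputable section

namespace Schrodinger

/-! ### Unbounded operators: resolvent, spectrum, relative compactness -/

section Abstract

variable {X : Type*} [NormedAddCommGroup X] [InnerProductSpace ℂ X]

/-- `R` is the bounded, everywhere defined inverse `R(z, T) = (z - T)⁻¹` of `z - T : D(T) → X`.
Such an `R` is unique if it exists. -/
structure IsResolventAt (T : X →ₗ.[ℂ] X) (z : ℂ) (R : X →L[ℂ] X) : Prop where
  mem_domain : ∀ f : X, R f ∈ T.domain
  right_inv : ∀ f : X, z • R f - T ⟨R f, mem_domain f⟩ = f
  left_inv : ∀ u : T.domain, R (z • (u : X) - T u) = u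

/-- The resolvent set `ρ(T)`. -/
def resolventSet (T : X →ₗ.[ℂ] X) : Set ℂ := {z | ∃ R : X →L[ℂ] X, IsResolventAt T z R}

/-- The spectrum `σ(T) = ℂ \ ρ(T)`. -/
def spectrum (T : X →ₗ.[ℂ] X) : Set ℂ := (resolventSet T)ᶜ

/-- `A` is relatively compact with respect to `T`: `T` is densely defined with non-empty resolvent
set, `D(T) ⊆ D(A)`, and `A R(z, T)` is a compact operator on `X` for some `z ∈ ρ(T)`. -/
def IsRelativelyCompact (A T : X →ₗ.[ℂ] X) : Prop :=
  Dense (T.domain : Set X) ∧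
    ∃ (hTA : T.domain ≤ A.domain) (z : ℂ) (R : X →L[ℂ] X) (hR : IsResolventAt T z R),
      IsCompactOperator fun f : X => A ⟨R f, hTA (hR.mem_domain f)⟩

/-- The kernel of `(T - l)ᵏ` on its natural domain:
`ker (T - l)ᵏ⁺¹ = {u ∈ D(T) | (T - l) u ∈ ker (T - l)ᵏ}`. -/
def kerPow (T : X →ₗ.[ℂ] X) (l : ℂ) : ℕ → Submodule ℂ X
  | 0 => ⊥
  | k + 1 => ((kerPow T l k).comap (T.toFun - l • T.domain.subtype)).map T.domain.subtype

/-- The space `⋃ₖ ker (T - l)ᵏ` of generalized eigenvectors (an increasing union), whose dimension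
is the algebraic multiplicity of `l`. -/
def rootSpace (T : X →ₗ.[ℂ] X) (l : ℂ) : Submodule ℂ X := ⨆ k, kerPow T l k

/-- The isolated points of the spectrum which are eigenvalues of finite algebraic multiplicity. -/
def discreteSpectrum (T : X →ₗ.[ℂ] X) : Set ℂ :=
  {l | l ∈ spectrum T ∧ (∃ ε > 0, ∀ z ∈ spectrum T, dist z l < ε → z = l) ∧
    (∃ u : T.domain, (u : X) ≠ 0 ∧ T u = l • (u : X)) ∧ FiniteDimensional ℂ (rootSpace T l)}

/-- The essential spectrum of a (not necessarily self-adjoint) operator: the part of the spectrum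
that is common to all compact perturbations, `⋂ {σ(T + K) | K compact}`. -/
def essentialSpectrum (T : X →ₗ.[ℂ] X) : Set ℂ :=
  {l | ∀ K : X →L[ℂ] X, IsCompactOperator K → l ∈ spectrum ((K : X →ₗ[ℂ] X) +ᵥ T)}

/-- Purely discrete spectrum: the essential spectrum is empty, and the spectrum consists only of
isolated eigenvalues of finite algebraic multiplicity. -/
def HasPurelyDiscreteSpectrum (T : X →ₗ.[ℂ] X) : Prop :=
  essentialSpectrum T = ∅ ∧ spectrum T = discreteSpectrum T

end Abstract

/-! ### Schrödinger operators on `L²(ℝⁿ)` -/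

/-- The complex Hilbert space `L²(ℝⁿ)`. -/
abbrev L2 (n : ℕ) : Type := Lp ℂ 2 (volume : Measure (EuclideanSpace ℝ (Fin n)))

/-- The domain `{u ∈ L² | V u ∈ L²}` of the operator of multiplication by `V`. -/
def mulDomain {n : ℕ} (V : EuclideanSpace ℝ (Fin n) → ℂ) : Submodule ℂ (L2 n) where
  carrier := {u | MemLp (fun x => V x * u x) 2 volume}
  add_mem' := fun {u v} hu hv => by
    refine (memLp_congr_ae ?_).2 (MemLp.add hu hv)
    filter_upwards [Lp.coeFn_add u v] with x hx
    rw [hx, Pi.add_apply, Pi.add_apply, mul_add]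
  zero_mem' := by
    refine (memLp_congr_ae ?_).2 (MemLp.zero (ε := ℂ))
    filter_upwards [Lp.coeFn_zero ℂ 2 (volume : Measure (EuclideanSpace ℝ (Fin n)))] with x hx
    rw [hx, Pi.zero_apply, mul_zero]
  smul_mem' := fun c u hu => by
    refine (memLp_congr_ae ?_).2 (MemLp.const_smul hu c)
    filter_upwards [Lp.coeFn_smul c u] with x hx
    rw [hx, Pi.smul_apply, Pi.smul_apply, smul_eq_mul, smul_eq_mul, mul_left_comm]

lemma mem_mulDomain {n : ℕ} {V : EuclideanSpace ℝ (Fin n) → ℂ} {u : L2 n} :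
    u ∈ mulDomain V ↔ MemLp (fun x => V x * u x) 2 volume := Iff.rfl

/-- The maximal operator of multiplication by `V` in `L²(ℝⁿ)`, `u ↦ V u`. -/
def mulOp {n : ℕ} (V : EuclideanSpace ℝ (Fin n) → ℂ) : L2 n →ₗ.[ℂ] L2 n where
  domain := mulDomain V
  toFun :=
    { toFun := fun u => MemLp.toLp (fun x => V x * u.1 x) (mem_mulDomain.1 u.2)
      map_add' := fun u v => by
        refine Eq.trans ?_ (MemLp.toLp_add (mem_mulDomain.1 u.2) (mem_mulDomain.1 v.2))
        refine (MemLp.toLp_eq_toLp_iff _ _).2 ?_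
        filter_upwards [Lp.coeFn_add u.1 v.1] with x hx
        rw [Submodule.coe_add, hx, Pi.add_apply, Pi.add_apply, mul_add]
      map_smul' := fun c u => by
        refine Eq.trans ?_ (MemLp.toLp_const_smul c (mem_mulDomain.1 u.2))
        refine (MemLp.toLp_eq_toLp_iff _ _).2 ?_
        filter_upwards [Lp.coeFn_smul c u.1] with x hx
        rw [Submodule.coe_smul, hx, Pi.smul_apply, Pi.smul_apply, smul_eq_mul, smul_eq_mul,
          mul_left_comm] }

/-- `g = (g₁, …, gₙ)` is the weak (distributional) gradient of `u`:
`∫ u ∂ᵢφ = - ∫ gᵢ φ` for all test functions `φ ∈ C_c^∞(ℝⁿ)` and all `i`. -/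
def HasWeakGradient {n : ℕ} (u : L2 n) (g : Fin n → L2 n) : Prop :=
  ∀ φ : EuclideanSpace ℝ (Fin n) → ℂ, ContDiff ℝ ∞ φ → HasCompactSupport φ → ∀ i : Fin n,
    ∫ x, u x * fderiv ℝ φ x (EuclideanSpace.single i 1) = - ∫ x, g i x * φ x

lemma integrable_L2_mul {n : ℕ} (u : L2 n) {φ : EuclideanSpace ℝ (Fin n) → ℂ}
    (hφ : Continuous φ) (hc : HasCompactSupport φ) : Integrable (fun x => u x * φ x) :=
  (Lp.memLp u).integrable_mul (q := 2) (hφ.memLp_of_hasCompactSupport hc)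

lemma HasWeakGradient.add {n : ℕ} {u v : L2 n} {g h : Fin n → L2 n} (hu : HasWeakGradient u g)
    (hv : HasWeakGradient v h) : HasWeakGradient (u + v) (g + h) := by
  intro φ hφ hc i
  have hd : Continuous fun x => fderiv ℝ φ x (EuclideanSpace.single i 1) :=
    (hφ.continuous_fderiv (by simp)).clm_apply continuous_const
  have hdc : HasCompactSupport fun x => fderiv ℝ φ x (EuclideanSpace.single i 1) :=
    hc.fderiv_apply ℝ _
  have e1 : ∫ x, (u + v : L2 n) x * fderiv ℝ φ x (EuclideanSpace.single i 1) =
      ∫ x, (u x * fderiv ℝ φ x (EuclideanSpace.single i 1)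
        + v x * fderiv ℝ φ x (EuclideanSpace.single i 1)) := by
    refine integral_congr_ae ?_
    filter_upwards [Lp.coeFn_add u v] with x hx
    rw [hx, Pi.add_apply, add_mul]
  have e2 : ∫ x, (g i + h i : L2 n) x * φ x = ∫ x, (g i x * φ x + h i x * φ x) := by
    refine integral_congr_ae ?_
    filter_upwards [Lp.coeFn_add (g i) (h i)] with x hx
    rw [hx, Pi.add_apply, add_mul]
  rw [Pi.add_apply, e1, e2, integral_add (integrable_L2_mul u hd hdc) (integrable_L2_mul v hd hdc),
    integral_add (integrable_L2_mul _ hφ.continuous hc) (integrable_L2_mul _ hφ.continuous hc),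
    hu φ hφ hc i, hv φ hφ hc i, neg_add]

lemma HasWeakGradient.smul {n : ℕ} {u : L2 n} {g : Fin n → L2 n} (c : ℂ)
    (hu : HasWeakGradient u g) : HasWeakGradient (c • u) (c • g) := by
  intro φ hφ hc i
  have e1 : ∫ x, (c • u : L2 n) x * fderiv ℝ φ x (EuclideanSpace.single i 1) =
      ∫ x, c * (u x * fderiv ℝ φ x (EuclideanSpace.single i 1)) := by
    refine integral_congr_ae ?_
    filter_upwards [Lp.coeFn_smul c u] with x hx
    rw [hx, Pi.smul_apply, smul_eq_mul, mul_assoc]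
  have e2 : ∫ x, (c • g i : L2 n) x * φ x = ∫ x, c * (g i x * φ x) := by
    refine integral_congr_ae ?_
    filter_upwards [Lp.coeFn_smul c (g i)] with x hx
    rw [hx, Pi.smul_apply, smul_eq_mul, mul_assoc]
  rw [Pi.smul_apply, e1, e2, integral_const_mul, integral_const_mul, hu φ hφ hc i, mul_neg]

lemma hasWeakGradient_zero {n : ℕ} : HasWeakGradient (0 : L2 n) 0 := by
  intro φ _ _ i
  have e : ∀ ψ : EuclideanSpace ℝ (Fin n) → ℂ, ∫ x, (0 : L2 n) x * ψ x = 0 := fun ψ => by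
    refine integral_eq_zero_of_ae ?_
    filter_upwards [Lp.coeFn_zero ℂ 2 (volume : Measure (EuclideanSpace ℝ (Fin n)))] with x hx
    rw [hx, Pi.zero_apply, zero_mul]
  rw [Pi.zero_apply, e, e, neg_zero]

lemma HasWeakGradient.eq_zero {n : ℕ} {g : Fin n → L2 n}
    (hg : HasWeakGradient (0 : L2 n) g) (i : Fin n) : g i = 0 := by
  rw [Lp.eq_zero_iff_ae_eq_zero]
  have hloc : LocallyIntegrable (g i : EuclideanSpace ℝ (Fin n) → ℂ) volume :=
    (Lp.memLp (g i)).locallyIntegrable one_le_two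
  refine ae_eq_zero_of_integral_contDiff_smul_eq_zero hloc fun φ hφ hc => ?_
  have h := hg (fun x => (φ x : ℂ)) (Complex.ofRealCLM.contDiff.comp hφ)
    (hc.comp_left (g := fun t : ℝ => (t : ℂ)) Complex.ofReal_zero) i
  have e : ∫ x, (0 : L2 n) x *
      fderiv ℝ (fun x => (φ x : ℂ)) x (EuclideanSpace.single i 1) = 0 := by
    refine integral_eq_zero_of_ae ?_
    filter_upwards [Lp.coeFn_zero ℂ 2 (volume : Measure (EuclideanSpace ℝ (Fin n)))] with x hx
    rw [hx, Pi.zero_apply, zero_mul]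
  rw [e, zero_eq_neg] at h
  rw [← h]
  refine integral_congr_ae (Eventually.of_forall fun x => ?_)
  simp [mul_comm]

/-- Multiplication by `W^{1/2}`, for `W ≥ 0`. -/
def sqrtOp {n : ℕ} (W : EuclideanSpace ℝ (Fin n) → ℝ) : L2 n →ₗ.[ℂ] L2 n :=
  mulOp fun x => (√(W x) : ℂ)

/-- The form domain `{u ∈ H¹(ℝⁿ) | W^{1/2} u ∈ L²(ℝⁿ)}` of `-Δ + W`, for `W ≥ 0`. -/
def formDomain {n : ℕ} (W : EuclideanSpace ℝ (Fin n) → ℝ) : Submodule ℂ (L2 n) where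
  carrier := {u | u ∈ (sqrtOp W).domain ∧ ∃ g, HasWeakGradient u g}
  add_mem' := fun ⟨hu, _, hg⟩ ⟨hv, _, hh⟩ => ⟨add_mem hu hv, _, hg.add hh⟩
  zero_mem' := ⟨zero_mem _, _, hasWeakGradient_zero⟩
  smul_mem' := fun c _ ⟨hu, _, hg⟩ => ⟨Submodule.smul_mem _ c hu, _, hg.smul c⟩

/-- The graph of the operator associated with the form
`a(u, v) = ∫ ∇u · conj ∇v + ∫ W u conj v` on the form domain: the pairs `(u, f)` such that `u` is in
the form domain and `a(u, v) = ∫ f conj v` for all `v` in the form domain. (The inner product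
`⟪v, u⟫ = ∫ u conj v` is linear in the second variable.) -/
def formGraph {n : ℕ} (W : EuclideanSpace ℝ (Fin n) → ℝ) : Submodule ℂ (L2 n × L2 n) where
  carrier := {p | ∃ (hu : p.1 ∈ (sqrtOp W).domain) (g : Fin n → L2 n), HasWeakGradient p.1 g ∧
    ∀ (v : L2 n) (hv : v ∈ (sqrtOp W).domain) (h : Fin n → L2 n), HasWeakGradient v h →
      ∑ i, ⟪h i, g i⟫_ℂ + ⟪sqrtOp W ⟨v, hv⟩, sqrtOp W ⟨p.1, hu⟩⟫_ℂ = ⟪v, p.2⟫_ℂ}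
  add_mem' := by
    rintro p q ⟨hu, g, hg, hp⟩ ⟨hu', g', hg', hq⟩
    refine ⟨add_mem hu hu', g + g', hg.add hg', fun v hv h hh => ?_⟩
    have e : sqrtOp W ⟨(p + q).1, add_mem hu hu'⟩ = sqrtOp W ⟨p.1, hu⟩ + sqrtOp W ⟨q.1, hu'⟩ :=
      (sqrtOp W).map_add ⟨p.1, hu⟩ ⟨q.1, hu'⟩
    rw [e, Prod.snd_add, inner_add_right, inner_add_right, ← hp v hv h hh, ← hq v hv h hh]
    simp only [Pi.add_apply, inner_add_right, Finset.sum_add_distrib]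
    ring
  zero_mem' := by
    refine ⟨zero_mem _, 0, hasWeakGradient_zero, fun v hv h hh => ?_⟩
    have e : sqrtOp W ⟨(0 : L2 n × L2 n).1, zero_mem _⟩ = 0 := (sqrtOp W).map_zero
    rw [e]
    simp
  smul_mem' := by
    rintro c p ⟨hu, g, hg, hp⟩
    refine ⟨Submodule.smul_mem _ c hu, c • g, hg.smul c, fun v hv h hh => ?_⟩
    have e : sqrtOp W ⟨(c • p).1, Submodule.smul_mem _ c hu⟩ = c • sqrtOp W ⟨p.1, hu⟩ :=
      (sqrtOp W).map_smul c ⟨p.1, hu⟩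
    rw [e, Prod.smul_snd, inner_smul_right, inner_smul_right, ← hp v hv h hh]
    simp only [Pi.smul_apply, inner_smul_right, ← Finset.mul_sum]
    ring

/-- The graph is single valued as soon as the form domain is dense in `L²(ℝⁿ)`. -/
lemma formGraph_single_valued {n : ℕ} {W : EuclideanSpace ℝ (Fin n) → ℝ}
    (hd : Dense (formDomain W : Set (L2 n))) (p : L2 n × L2 n) (hp : p ∈ formGraph W)
    (h0 : p.1 = 0) : p.2 = 0 := by
  obtain ⟨u, f⟩ := p
  obtain rfl : u = 0 := h0
  obtain ⟨hu, g, hg, hp⟩ := hp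
  refine hd.eq_zero_of_inner_right ℂ fun v hv => ?_
  obtain ⟨hv, h, hh⟩ := hv
  have e : sqrtOp W ⟨(0 : L2 n), hu⟩ = 0 := (sqrtOp W).map_zero
  have := hp v hv h hh
  rw [e] at this
  simpa [hg.eq_zero] using this.symm

/-- The operator `-Δ + W` in `L²(ℝⁿ)`, for a measurable function `W ≥ 0`: the operator associated
with the closed form `∫ |∇u|² + ∫ W |u|²`. It is the usual self-adjoint realization; for `W` locally
integrable its domain is `{u ∈ L² | W u ∈ L¹_loc, -Δu + W u ∈ L²}`. Only a densely defined operator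
is meaningful here, and then the form domain is dense and the graph is single valued. -/
def realSchrodingerOp {n : ℕ} (W : EuclideanSpace ℝ (Fin n) → ℝ) : L2 n →ₗ.[ℂ] L2 n :=
  (formGraph W).toLinearPMap

/-- The operator `-Δ + V` in `L²(ℝⁿ)`, for complex `V` with `Re V ≥ 0`: the operator sum
`(-Δ + Re V) + i Im V`, with domain `{u ∈ D(-Δ + Re V) | (Im V) u ∈ L²}`. -/
def schrodingerOp {n : ℕ} (V : EuclideanSpace ℝ (Fin n) → ℂ) : L2 n →ₗ.[ℂ] L2 n :=
  realSchrodingerOp (fun x => (V x).re) + mulOp fun x => Complex.I * ((V x).im : ℂ)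

end Schrodinger

namespace Schrodinger

/-! ### Compact operators -/

section CompactOperators

variable {X : Type*} [NormedAddCommGroup X] [InnerProductSpace ℂ X]

/-! It suffices to find one compact resolvent of `-Δ + V`. If `R = (z - T)⁻¹` is compact, the
identity `(l - T) R = 1 - (z - l) R` transfers Riesz theory from `R` to `T`. Each spectral point `l`
of `T` gives a nonzero eigenvalue `(z - l)⁻¹` of `R`, only finitely many of these have modulus above
a given `ε > 0`, and the root space of `T` at `l` lies in a finite dimensional union of kernels of
powers of `1 - (z - l) R`. Both finiteness statements come from Riesz's lemma along a chain of
closed subspaces (`IsCompactOperator.not_strictMono_chain`). The essential spectrum is empty because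
a suitable compact perturbation moves any given `l` into the resolvent set. All this is collected in
`IsResolventAt.hasPurelyDiscreteSpectrum`.

For `-Δ + Re V`, the energy identity bounds `R f` in the form norm, and form balls are totally
bounded in `L²` (`totallyBounded_formBall`). Since `Re V → ∞`, tails outside a large ball are
uniformly small; inside, the translation estimate for weakly differentiable functions allows
approximation by functions constant on small cubes, which form a finite dimensional space.

The term `A = i Im V` is added by `IsResolventAt.exists_isResolventAt_add`: `(w - T - A) R` is the
identity plus a compact operator, hence invertible unless `w` is an eigenvalue of `T + A`. The point
`w = -1` is not one, since `A` contributes nothing to the real part of `⟪u, (T + A) u⟫`, which is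
therefore nonnegative. -/

/-- A compact operator cannot act along a strictly increasing chain of closed subspaces as
multiplication by scalars which are bounded away from zero, modulo the previous subspace. -/
lemma _root_.IsCompactOperator.not_strictMono_chain {R : X →L[ℂ] X} (hR : IsCompactOperator R)
    {M : ℕ → Submodule ℂ X} (hc : ∀ k, IsClosed (M k : Set X)) (hM : StrictMono M)
    {m : ℕ → ℂ} {ε : ℝ} (hε : 0 < ε) (hm : ∀ k, ε ≤ ‖m k‖)
    (h : ∀ k, ∀ x ∈ M (k + 1), R x - m k • x ∈ M k) : False := by
  -- Riesz's lemma in unnormalized form: rescaling by powers of the scalar `2` gives distance at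
  -- least `1` from `M k` with norm at most `3`, where any bound above `2` would do.
  have key : ∀ k, ∃ x ∈ M (k + 1), ‖x‖ ≤ 3 ∧ ∀ y ∈ M k, 1 ≤ ‖x - y‖ := by
    intro k
    have h1 : IsClosed ((M k).comap (M (k + 1)).subtype : Set (M (k + 1))) :=
      (hc k).preimage continuous_subtype_val
    obtain ⟨x, hx, hx'⟩ := SetLike.exists_of_lt (hM (Nat.lt_succ_self k))
    obtain ⟨⟨y, hy⟩, hy3, hy1⟩ := riesz_lemma_of_norm_lt (c := (2 : ℂ)) (R := 3) (by simp)
      (by norm_num) h1 ⟨⟨x, hx⟩, hx'⟩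
    refine ⟨y, hy, hy3, fun w hw => ?_⟩
    exact hy1 ⟨w, hM.monotone (Nat.le_succ k) hw⟩ hw
  choose x hxM hx3 hx1 using key
  have hRM : ∀ k, R (x k) ∈ M (k + 1) := fun k => by
    have := add_mem (hM.monotone (Nat.le_succ k) (h k _ (hxM k)))
      ((M (k + 1)).smul_mem (m k) (hxM k))
    rwa [sub_add_cancel] at this
  have sep : ∀ j k, j < k → ε ≤ ‖R (x k) - R (x j)‖ := by
    intro j k hjk
    have hm0 : m k ≠ 0 := norm_pos_iff.1 (hε.trans_le (hm k))
    have hjk' : M (j + 1) ≤ M k := hM.monotone hjk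
    have hw : (m k)⁻¹ • (R (x j) - (R (x k) - m k • x k)) ∈ M k :=
      (M k).smul_mem _ (sub_mem (hjk' (hRM j)) (h k _ (hxM k)))
    -- Modulo `M k`, the vector `R (x k)` is `m k • x k` and `R (x j)` vanishes, so the difference
    -- is `m k` times a vector of norm at least `1`.
    have e : R (x k) - R (x j) =
        m k • (x k - (m k)⁻¹ • (R (x j) - (R (x k) - m k • x k))) := by
      rw [smul_sub, smul_inv_smul₀ hm0]; abel
    rw [e, norm_smul]
    nlinarith [hx1 k _ hw, hm k]
  obtain ⟨K, hK, hK'⟩ := hR.image_closedBall_subset_compact (3 : ℝ)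
  obtain ⟨y, -, ψ, hψ, hψy⟩ := hK.tendsto_subseq
    (fun k => hK' ⟨x k, by simpa using hx3 k, rfl⟩)
  obtain ⟨N, hN⟩ := Metric.cauchySeq_iff'.1 hψy.cauchySeq ε hε
  have h1 := hN (N + 1) (Nat.le_succ N)
  rw [dist_eq_norm] at h1
  exact (sep _ _ (hψ (Nat.lt_succ_self N))).not_gt h1

/-- Infinitely many such eigenvalues would give independent eigenvectors, and the spans of the first
`k` of them form a forbidden chain. -/
lemma _root_.IsCompactOperator.finite_setOf_hasEigenvalue {R : X →L[ℂ] X} (hR : IsCompactOperator R)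
    {ε : ℝ} (hε : 0 < ε) :
    {m : ℂ | Module.End.HasEigenvalue (R : Module.End ℂ X) m ∧ ε ≤ ‖m‖}.Finite := by
  by_contra hinf
  have : Infinite {m : ℂ | Module.End.HasEigenvalue (R : Module.End ℂ X) m ∧ ε ≤ ‖m‖} :=
    Set.infinite_coe_iff.2 hinf
  let ν := Infinite.natEmbedding
    {m : ℂ | Module.End.HasEigenvalue (R : Module.End ℂ X) m ∧ ε ≤ ‖m‖}
  choose v hv using fun k => (ν k).2.1.exists_hasEigenvector
  have hli : LinearIndependent ℂ v := Module.End.eigenvectors_linearIndependent' _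
    (fun k => (ν k : ℂ)) (fun i j hij => ν.injective (Subtype.ext hij)) v hv
  refine IsCompactOperator.not_strictMono_chain hR
    (M := fun k => Submodule.span ℂ (v '' Set.Iio k)) (m := fun k => (ν k : ℂ))
    (fun k => ?_) (strictMono_nat_of_lt_succ fun k => ?_) hε (fun k => (ν k).2.2) ?_
  · have : FiniteDimensional ℂ (Submodule.span ℂ (v '' Set.Iio k)) :=
      FiniteDimensional.span_of_finite ℂ ((Set.finite_Iio k).image v)
    exact Submodule.closed_of_finiteDimensional _
  · refine SetLike.lt_iff_le_and_exists.2 ⟨Submodule.span_mono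
      (Set.image_mono (Set.Iio_subset_Iio (Nat.le_succ k))), v k,
      Submodule.subset_span ⟨k, Nat.lt_succ_self k, rfl⟩, ?_⟩
    exact hli.notMem_span_image (by simp)
  · intro k x hx
    have hle : Submodule.span ℂ (v '' Set.Iio (k + 1)) ≤
        (Submodule.span ℂ (v '' Set.Iio k)).comap
          ((R : X →ₗ[ℂ] X) - (ν k : ℂ) • LinearMap.id) := by
      rw [Submodule.span_le]
      rintro _ ⟨i, hi, rfl⟩
      have hRi : R (v i) = (ν i : ℂ) • v i := (hv i).apply_eq_smul
      simp only [SetLike.mem_coe, Submodule.mem_comap, LinearMap.sub_apply, LinearMap.smul_apply,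
        LinearMap.id_apply, ContinuousLinearMap.coe_coe]
      rw [hRi]
      rcases Nat.lt_succ_iff_lt_or_eq.1 hi with h | rfl
      · rw [← sub_smul]
        exact Submodule.smul_mem _ _ (Submodule.subset_span ⟨i, h, rfl⟩)
      · simp
    exact hle hx

lemma _root_.IsCompactOperator.exists_one_sub_pow {R : X →L[ℂ] X} (hR : IsCompactOperator R) (k : ℕ) :
    ∃ L : X →L[ℂ] X, IsCompactOperator L ∧ (1 - R) ^ k = 1 - L := by
  induction k with
  | zero => exact ⟨0, isCompactOperator_zero, by simp⟩
  | succ k ih =>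
    obtain ⟨L, hL, e⟩ := ih
    refine ⟨L + R - L * R, (hL.add hR).sub (hL.comp_clm R), ?_⟩
    rw [pow_succ, e]; noncomm_ring

/-- `R` restricts to the identity on this kernel, so the identity there is compact. -/
lemma _root_.IsCompactOperator.finiteDimensional_ker_one_sub [CompleteSpace X] {R : X →L[ℂ] X}
    (hR : IsCompactOperator R) :
    FiniteDimensional ℂ (LinearMap.ker ((1 - R : X →L[ℂ] X) : X →ₗ[ℂ] X)) := by
  have hker : ∀ v ∈ LinearMap.ker ((1 - R : X →L[ℂ] X) : X →ₗ[ℂ] X), R v = v := fun v hv => by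
    have : v - R v = 0 := hv
    exact (sub_eq_zero.1 this).symm
  have hcomp : CompleteSpace (LinearMap.ker ((1 - R : X →L[ℂ] X) : X →ₗ[ℂ] X)) :=
    (ContinuousLinearMap.isClosed_ker (1 - R : X →L[ℂ] X)).completeSpace_coe
  have hmem : ∀ v ∈ LinearMap.ker ((1 - R : X →L[ℂ] X) : X →ₗ[ℂ] X),
      (R : X →ₗ[ℂ] X) v ∈ LinearMap.ker ((1 - R : X →L[ℂ] X) : X →ₗ[ℂ] X) := fun v hv => by
    rw [ContinuousLinearMap.coe_coe, hker v hv]; exact hv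
  have h := IsCompactOperator.restrict' (f := (R : X →ₗ[ℂ] X)) hR hmem
  refine FiniteDimensional.of_isCompactOperator_id (𝕜 := ℂ) ?_
  convert! h using 1
  funext v
  exact Subtype.ext (hker v v.2).symm

/-- Finite ascent: the kernels of the powers either stabilize or form a strictly increasing chain on
which `R` acts as `1` modulo the previous kernel. -/
lemma _root_.IsCompactOperator.exists_ker_one_sub_pow_le [CompleteSpace X] {R : X →L[ℂ] X}
    (hR : IsCompactOperator R) :
    ∃ N : Submodule ℂ X, FiniteDimensional ℂ N ∧
      ∀ k, LinearMap.ker (((1 - R : X →L[ℂ] X) : Module.End ℂ X) ^ k) ≤ N := by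
  set S : Module.End ℂ X := ((1 - R : X →L[ℂ] X) : Module.End ℂ X) with hS
  have hcoe : ∀ k, (((1 - R) ^ k : X →L[ℂ] X) : Module.End ℂ X) = S ^ k := fun k =>
    map_pow (ContinuousLinearMap.toLinearMapRingHom : (X →L[ℂ] X) →+* Module.End ℂ X) (1 - R) k
  have hmono : ∀ k, LinearMap.ker (S ^ k) ≤ LinearMap.ker (S ^ (k + 1)) := fun k x hx => by
    rw [LinearMap.mem_ker] at hx ⊢
    rw [pow_succ', Module.End.mul_apply, hx, map_zero]
  have hfin : ∀ k, FiniteDimensional ℂ (LinearMap.ker (S ^ k)) := fun k => by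
    obtain ⟨L, hL, e⟩ := IsCompactOperator.exists_one_sub_pow hR k
    rw [← hcoe, e]
    exact IsCompactOperator.finiteDimensional_ker_one_sub hL
  by_cases hst : ∃ k, LinearMap.ker (S ^ k) = LinearMap.ker (S ^ (k + 1))
  · obtain ⟨k, hk⟩ := hst
    refine ⟨LinearMap.ker (S ^ k), hfin k, fun j => ?_⟩
    rw [Module.End.ker_pow_constant hk j]
    exact monotone_nat_of_le_succ hmono (Nat.le_add_left j k)
  · push Not at hst
    refine (IsCompactOperator.not_strictMono_chain hR (M := fun k => LinearMap.ker (S ^ k))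
      (m := fun _ => 1) (fun k => ?_)
      (strictMono_nat_of_lt_succ fun k => lt_of_le_of_ne (hmono k) (hst k)) one_pos
      (fun _ => by simp) fun k x hx => ?_).elim
    · have := hfin k
      exact Submodule.closed_of_finiteDimensional _
    · have e : R x - (1 : ℂ) • x = -(S x) := by simp [hS]
      have hx' : (S ^ k) (S x) = 0 := by
        rw [← Module.End.mul_apply, ← pow_succ]; exact hx
      rw [e, LinearMap.mem_ker, map_neg, hx', neg_zero]

/-- The Fredholm alternative, through `1 - c R = c (c⁻¹ - R)`. -/
lemma _root_.IsCompactOperator.isUnit_one_sub_smul [CompleteSpace X] {R : X →L[ℂ] X}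
    (hR : IsCompactOperator R) {c : ℂ} (hc : c ≠ 0)
    (h : ¬ Module.End.HasEigenvalue (R : Module.End ℂ X) c⁻¹) : IsUnit (1 - c • R) := by
  have h1 := (hR.hasEigenvalue_or_mem_resolventSet (inv_ne_zero hc)).resolve_left h
  rw [_root_.spectrum.mem_resolventSet_iff] at h1
  have h2 := (Units.mk0 c hc).isUnit.map (algebraMap ℂ (X →L[ℂ] X)) |>.mul h1
  convert h2 using 1
  ext x
  simp [Algebra.algebraMap_eq_smul_one, smul_sub, hc]

lemma _root_.IsCompactOperator.isUnit_one_add_of_injective [CompleteSpace X] {C : X →L[ℂ] X}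
    (hC : IsCompactOperator C) (h : ∀ f, f + C f = 0 → f = 0) : IsUnit (1 + C) := by
  have := IsCompactOperator.isUnit_one_sub_smul hC (c := -1) (by simp) fun he => ?_
  · simpa using this
  · obtain ⟨v, hv⟩ := he.exists_hasEigenvector
    have h1 : C v = (-1 : ℂ)⁻¹ • v := hv.apply_eq_smul
    exact hv.2 (h v (by rw [h1]; norm_num))

/-- A compact operator is approximated in norm by operators of finite rank. -/
lemma _root_.IsCompactOperator.exists_isCompactOperator_norm_sub_comp_le {R : X →L[ℂ] X}
    (hR : IsCompactOperator R) {δ : ℝ} (hδ : 0 < δ) :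
    ∃ P : X →L[ℂ] X, IsCompactOperator P ∧ ‖R - P * R‖ ≤ δ := by
  obtain ⟨K, hK, hK'⟩ := hR.image_closedBall_subset_compact (1 : ℝ)
  obtain ⟨t, -, htf, ht⟩ := Metric.finite_approx_of_totallyBounded hK.totallyBounded δ hδ
  have hfd : FiniteDimensional ℂ (Submodule.span ℂ t) := FiniteDimensional.span_of_finite ℂ htf
  -- `t` is a finite `δ`-net for the image of the unit ball; the orthogonal projection approximates
  -- at least as well as the nearest point of the net.
  refine ⟨(Submodule.span ℂ t).starProjection, ?_, ?_⟩
  · have hprop : ProperSpace (Submodule.span ℂ t) := FiniteDimensional.proper ℂ _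
    have hsub : IsCompactOperator (Submodule.span ℂ t).subtypeL :=
      isCompactOperator_of_locallyCompactSpace_rng _
    exact hsub.comp_clm (Submodule.span ℂ t).orthogonalProjectionOnto
  · refine ContinuousLinearMap.opNorm_le_of_unit_norm hδ.le fun x hx => ?_
    have hxK : R x ∈ K := hK' ⟨x, by simp [hx], rfl⟩
    obtain ⟨y, hy, hxy⟩ := Set.mem_iUnion₂.1 (ht hxK)
    have h1 : ‖R x - (Submodule.span ℂ t).starProjection (R x)‖ ≤ ‖R x - y‖ := by
      rw [Submodule.starProjection_minimal]
      exact ciInf_le ⟨0, by rintro _ ⟨z, rfl⟩; exact norm_nonneg _⟩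
        (⟨y, Submodule.subset_span hy⟩ : Submodule.span ℂ t)
    exact h1.trans (by simpa [dist_eq_norm] using (Metric.mem_ball.1 hxy).le)

end CompactOperators

/-! ### Operators with compact resolvent -/

section CompactResolvent

variable {X : Type*} [NormedAddCommGroup X] [InnerProductSpace ℂ X]

/-- If `(w - T) R = C` with `C` invertible and `R` maps onto the domain of `T`, then
`R C⁻¹` is the resolvent of `T` at `w`. -/
lemma exists_isResolventAt_of_isUnit {T : X →ₗ.[ℂ] X} {w : ℂ} {R C : X →L[ℂ] X}
    (hmem : ∀ f, R f ∈ T.domain) (hsurj : ∀ u : T.domain, ∃ f, R f = u)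
    (hC : ∀ f, w • R f - T ⟨R f, hmem f⟩ = C f) (hu : IsUnit C) :
    ∃ D : X →L[ℂ] X, IsResolventAt T w (R * D) := by
  obtain ⟨U, rfl⟩ := hu
  refine ⟨(U⁻¹ : (X →L[ℂ] X)ˣ), ⟨fun f => hmem _, fun f => ?_, fun u => ?_⟩⟩
  · refine (hC (((U⁻¹ : (X →L[ℂ] X)ˣ) : X →L[ℂ] X) f)).trans ?_
    rw [← mul_apply_eq_comp, Units.mul_inv]; rfl
  · obtain ⟨f, hf⟩ := hsurj u
    obtain rfl : u = ⟨R f, hmem f⟩ := Subtype.ext hf.symm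
    rw [hC f, mul_apply_eq_comp, ← mul_apply_eq_comp _ (U : X →L[ℂ] X),
      Units.inv_mul]; rfl

variable {T : X →ₗ.[ℂ] X} {z : ℂ} {R : X →L[ℂ] X}

lemma IsResolventAt.map_apply (hR : IsResolventAt T z R) (f : X) :
    T ⟨R f, hR.mem_domain f⟩ = z • R f - f := by
  have := hR.right_inv f
  exact eq_sub_of_add_eq' (sub_eq_iff_eq_add.1 this).symm

lemma IsResolventAt.exists_apply_eq (hR : IsResolventAt T z R) (u : T.domain) :
    ∃ f, R f = u := ⟨_, hR.left_inv u⟩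

lemma IsResolventAt.hasEigenvalue [CompleteSpace X] (hR : IsResolventAt T z R)
    (hc : IsCompactOperator R) {l : ℂ} (hl : l ∈ spectrum T) :
    z - l ≠ 0 ∧ Module.End.HasEigenvalue (R : Module.End ℂ X) (z - l)⁻¹ := by
  have hne : z - l ≠ 0 := fun h => hl ⟨R, by rwa [← sub_eq_zero.1 h]⟩
  refine ⟨hne, by_contra fun hev => hl ?_⟩
  have hC : ∀ f, l • R f - T ⟨R f, hR.mem_domain f⟩ = (1 - (z - l) • R : X →L[ℂ] X) f :=
    fun f => by rw [hR.map_apply]; simp [sub_smul]; abel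
  obtain ⟨D, hD⟩ := exists_isResolventAt_of_isUnit hR.mem_domain hR.exists_apply_eq hC
    (IsCompactOperator.isUnit_one_sub_smul hc hne hev)
  exact ⟨_, hD⟩

lemma IsResolventAt.exists_eigenvector [CompleteSpace X] (hR : IsResolventAt T z R)
    (hc : IsCompactOperator R) {l : ℂ} (hl : l ∈ spectrum T) :
    ∃ u : T.domain, (u : X) ≠ 0 ∧ T u = l • (u : X) := by
  obtain ⟨hne, hev⟩ := hR.hasEigenvalue hc hl
  obtain ⟨v, hv⟩ := hev.exists_hasEigenvector
  have hRv : R ((z - l) • v) = v := by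
    rw [map_smul]
    have : R v = (z - l)⁻¹ • v := hv.apply_eq_smul
    rw [this, smul_inv_smul₀ hne]
  refine ⟨⟨R ((z - l) • v), hR.mem_domain _⟩, ?_, ?_⟩
  · simpa [hRv] using hv.2
  · rw [hR.map_apply]
    simp only [hRv]
    rw [sub_smul]; abel

lemma IsResolventAt.isolated [CompleteSpace X] (hR : IsResolventAt T z R)
    (hc : IsCompactOperator R) (l : ℂ) :
    ∃ ε > 0, ∀ w ∈ spectrum T, dist w l < ε → w = l := by
  -- For such `w`, `‖z - w‖ ≤ ‖z - l‖ + 1`, so the eigenvalue `(z - w)⁻¹` of `R` stays away from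
  -- `0`; `m ↦ z - m⁻¹` recovers `w`.
  have hfin : {w | w ∈ spectrum T ∧ dist w l < 1}.Finite := by
    have hpos : 0 < (‖z - l‖ + 1)⁻¹ := by positivity
    refine Set.Finite.subset (((IsCompactOperator.finite_setOf_hasEigenvalue hc hpos).image
      fun m => z - m⁻¹)) fun w hw => ⟨(z - w)⁻¹, ?_, by simp⟩
    obtain ⟨hne, hev⟩ := hR.hasEigenvalue hc hw.1
    refine ⟨hev, ?_⟩
    rw [norm_inv]
    refine inv_anti₀ (norm_pos_iff.2 hne) ?_
    have h1 : dist w l = ‖l - w‖ := by rw [dist_comm, dist_eq_norm]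
    have h2 : z - w = (z - l) + (l - w) := by ring
    rw [h2]
    refine (norm_add_le _ _).trans ?_
    linarith [hw.2]
  have hopen : IsOpen ({w | w ∈ spectrum T ∧ dist w l < 1} \ {l})ᶜ :=
    (hfin.subset Set.sdiff_subset).isClosed.isOpen_compl
  obtain ⟨ε, hε, hb⟩ := Metric.isOpen_iff.1 hopen l (by simp)
  refine ⟨min ε 1, by positivity, fun w hw hd => by_contra fun hne => ?_⟩
  exact hb (Metric.mem_ball.2 (hd.trans_le (min_le_left _ _)))
    ⟨⟨hw, hd.trans_le (min_le_right _ _)⟩, hne⟩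

/-- On the domain, `1 - (z - l) R` equals `-R (T - l)`, and `R` commutes with its powers, so each
factor `T - l` can be traded for one factor `1 - (z - l) R`. -/
lemma IsResolventAt.kerPow_le (hR : IsResolventAt T z R) (l : ℂ) (k : ℕ) :
    kerPow T l k ≤
      LinearMap.ker (((1 - (z - l) • R : X →L[ℂ] X) : Module.End ℂ X) ^ k) := by
  induction k with
  | zero => simp [kerPow]
  | succ k ih =>
    rintro _ ⟨u, hu, rfl⟩
    set S : Module.End ℂ X := ((1 - (z - l) • R : X →L[ℂ] X) : Module.End ℂ X) with hS
    have h1 : (S ^ k) (T u - l • (u : X)) = 0 := ih hu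
    have hcomm : Commute (S ^ k) (R : Module.End ℂ X) := by
      refine Commute.pow_left ?_ k
      ext x
      simp [hS]
    have h2 : S u = -((R : Module.End ℂ X) (T u - l • (u : X))) := by
      have := hR.left_inv u
      rw [map_sub, map_smul] at this
      simp only [hS, ContinuousLinearMap.coe_coe, map_sub, map_smul,
        sub_apply, one_apply_eq_self, smul_apply, sub_smul]
      nth_rw 1 [← this]
      abel
    rw [LinearMap.mem_ker, pow_succ, Module.End.mul_apply, Submodule.subtype_apply, h2, map_neg,
      ← Module.End.mul_apply, hcomm.eq, Module.End.mul_apply, h1, map_zero, neg_zero]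

lemma IsResolventAt.finiteDimensional_rootSpace [CompleteSpace X] (hR : IsResolventAt T z R)
    (hc : IsCompactOperator R) (l : ℂ) : FiniteDimensional ℂ (rootSpace T l) := by
  obtain ⟨N, hN, hle⟩ := IsCompactOperator.exists_ker_one_sub_pow_le
    (R := (z - l) • R) (hc.smul (z - l))
  exact Submodule.finiteDimensional_of_le (iSup_le fun k => (hR.kerPow_le l k).trans (hle k))

lemma IsResolventAt.essentialSpectrum_eq_empty [CompleteSpace X] (hR : IsResolventAt T z R)
    (hc : IsCompactOperator R) : essentialSpectrum T = ∅ := by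
  refine Set.eq_empty_of_forall_notMem fun l hl => ?_
  have hδ : 0 < (‖z - l‖ + 1)⁻¹ := by positivity
  obtain ⟨P, hP, hle⟩ := IsCompactOperator.exists_isCompactOperator_norm_sub_comp_le hc hδ
  have hlt : ‖(z - l) • (R - P * R)‖ < 1 := by
    rw [norm_smul]
    calc ‖z - l‖ * ‖R - P * R‖ ≤ ‖z - l‖ * (‖z - l‖ + 1)⁻¹ := by gcongr
      _ < (‖z - l‖ + 1) * (‖z - l‖ + 1)⁻¹ := by gcongr; linarith
      _ = 1 := mul_inv_cancel₀ (by positivity)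
  -- This perturbation turns `1 - (z - l) R` into `1 - (z - l) (R - P R)`, which a Neumann series
  -- inverts.
  refine hl (-((z - l) • P)) (hP.smul (z - l)).neg ?_
  have hC : ∀ f, l • R f - (((-((z - l) • P) : X →L[ℂ] X) : X →ₗ[ℂ] X) +ᵥ T)
      ⟨R f, hR.mem_domain f⟩ = (1 - (z - l) • (R - P * R) : X →L[ℂ] X) f := fun f => by
    change l • R f - (-((z - l) • P (R f)) + T ⟨R f, hR.mem_domain f⟩) = _
    rw [hR.map_apply]
    simp [sub_smul, smul_sub]; abel
  obtain ⟨D, hD⟩ := exists_isResolventAt_of_isUnit (T := _ +ᵥ T) hR.mem_domain hR.exists_apply_eq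
    hC (isUnit_one_sub_of_norm_lt_one hlt)
  exact ⟨_, hD⟩

/-- An operator with compact resolvent has purely discrete spectrum. -/
theorem IsResolventAt.hasPurelyDiscreteSpectrum [CompleteSpace X] (hR : IsResolventAt T z R)
    (hc : IsCompactOperator R) : HasPurelyDiscreteSpectrum T := by
  refine ⟨hR.essentialSpectrum_eq_empty hc, Set.Subset.antisymm (fun l hl => ?_) fun l hl => hl.1⟩
  exact ⟨hl, hR.isolated hc l, hR.exists_eigenvector hc hl, hR.finiteDimensional_rootSpace hc l⟩

/-- A relatively compact perturbation of an operator with compact resolvent has compact resolvent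
at each point which is not an eigenvalue. -/
theorem IsResolventAt.exists_isResolventAt_add [CompleteSpace X] (hR : IsResolventAt T z R)
    (hc : IsCompactOperator R) {A : X →ₗ.[ℂ] X} (hTA : T.domain ≤ A.domain)
    (hA : IsCompactOperator fun f : X => A ⟨R f, hTA (hR.mem_domain f)⟩) {w : ℂ}
    (hw : ∀ u : T.domain, T u + A ⟨u, hTA u.2⟩ = w • (u : X) → (u : X) = 0) :
    ∃ S : X →L[ℂ] X, IsCompactOperator S ∧ IsResolventAt (T + A) w S := by
  let B : X →ₗ[ℂ] X :=
    { toFun := fun f => A ⟨R f, hTA (hR.mem_domain f)⟩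
      map_add' := fun f g => by
        rw [← A.map_add]; congr 1; ext; simp
      map_smul' := fun c f => by
        rw [RingHom.id_apply, ← A.map_smul]; congr 1; ext; simp }
  let B' : X →L[ℂ] X := ⟨B, IsCompactOperator.continuous (f := B) hA⟩
  have hB : ∀ f, B' f = A ⟨R f, hTA (hR.mem_domain f)⟩ := fun f => rfl
  have hB' : IsCompactOperator B' := hA
  have hmem : ∀ f, R f ∈ (T + A).domain := fun f => ⟨hR.mem_domain f, hTA (hR.mem_domain f)⟩
  have happ : ∀ f, (T + A) ⟨R f, hmem f⟩ = z • R f - f + B' f := fun f => by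
    rw [hB, ← hR.map_apply]; rfl
  have hC : IsCompactOperator ((w - z) • R - B' : X →L[ℂ] X) := (hc.smul (w - z)).sub hB'
  have hsum : ∀ f, w • R f - (T + A) ⟨R f, hmem f⟩ = (1 + ((w - z) • R - B') : X →L[ℂ] X) f :=
    fun f => by rw [happ]; simp [sub_smul]; abel
  -- A kernel vector `f` makes `R f` a solution of `(T + A) u = w u`, so `R f = 0` and then `f = (z
  -- - T) R f = 0`.
  have hunit : IsUnit (1 + ((w - z) • R - B')) := by
    refine IsCompactOperator.isUnit_one_add_of_injective hC fun f hf => ?_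
    have h1 : w • R f - (T + A) ⟨R f, hmem f⟩ = 0 := (hsum f).trans hf
    have h2 : R f = 0 := hw ⟨R f, hR.mem_domain f⟩ (sub_eq_zero.1 h1).symm
    have h3 : (⟨R f, hR.mem_domain f⟩ : T.domain) = 0 := Subtype.ext h2
    have h4 := hR.right_inv f
    rw [h3, T.map_zero, h2, smul_zero, sub_zero] at h4
    exact h4.symm
  obtain ⟨D, hD⟩ := exists_isResolventAt_of_isUnit hmem
    (fun u => hR.exists_apply_eq ⟨u, u.2.1⟩) hsum hunit
  exact ⟨R * D, hc.comp_clm D, hD⟩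

/-- A bounded set which is approximated by finite dimensional subspaces is totally bounded. -/
lemma totallyBounded_of_finiteDimensional_approx {B : Set X} {C : ℝ} (hB : ∀ u ∈ B, ‖u‖ ≤ C)
    (h : ∀ δ > 0, ∃ S : Submodule ℂ X, FiniteDimensional ℂ S ∧
      ∀ u ∈ B, ∃ v ∈ S, ‖u - v‖ ≤ δ) : TotallyBounded B := by
  rw [Metric.totallyBounded_iff]
  intro ε hε
  obtain ⟨S, hS, hBS⟩ := h (ε / 3) (by positivity)
  have hproper : ProperSpace S := FiniteDimensional.proper ℂ S
  have hK : IsCompact ((fun s : S => (s : X)) '' Metric.closedBall 0 (C + ε / 3)) :=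
    (isCompact_closedBall (0 : S) _).image continuous_subtype_val
  obtain ⟨t, -, htf, ht⟩ := Metric.finite_approx_of_totallyBounded hK.totallyBounded (ε / 3)
    (by positivity)
  refine ⟨t, htf, fun u hu => ?_⟩
  obtain ⟨v, hv, huv⟩ := hBS u hu
  have hvC : ‖v‖ ≤ C + ε / 3 := by
    have : ‖v‖ ≤ ‖u‖ + ‖u - v‖ := by
      have := norm_sub_le u (u - v)
      rwa [sub_sub_cancel] at this
    linarith [hB u hu]
  obtain ⟨y, hy, hvy⟩ := Set.mem_iUnion₂.1
    (ht ⟨⟨v, hv⟩, by simpa using hvC, rfl⟩)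
  refine Set.mem_iUnion₂.2 ⟨y, hy, ?_⟩
  rw [Metric.mem_ball] at hvy ⊢
  have h1 := dist_triangle u v y
  rw [dist_eq_norm u v] at h1
  change dist v y < ε / 3 at hvy
  linarith

end CompactResolvent

/-! ### Translations and weak gradients -/

section Translation

variable {n : ℕ}

lemma norm_integral_mul_le (u : L2 n) {φ : EuclideanSpace ℝ (Fin n) → ℂ} (hφ : MemLp φ 2 volume) :
    ‖∫ x, u x * φ x‖ ≤ ‖u‖ * (eLpNorm φ 2 volume).toReal := by
  have hstar : MemLp (fun x => conj (φ x)) 2 volume := hφ.star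
  have h1 : ∫ x, u x * φ x = ⟪hstar.toLp, u⟫_ℂ := by
    rw [L2.inner_def]
    refine integral_congr_ae ?_
    filter_upwards [hstar.coeFn_toLp] with x hx
    rw [hx]
    simp
  have h2 : eLpNorm (fun x => conj (φ x)) 2 volume = eLpNorm φ 2 volume :=
    eLpNorm_congr_norm_ae (Eventually.of_forall fun x => by simp)
  rw [h1]
  refine (norm_inner_le_norm _ _).trans ?_
  rw [Lp.norm_toLp, h2, mul_comm]

/-- An element of `L²` is bounded in norm by its pairings with test functions. -/
lemma norm_le_of_forall_testFunction {w : L2 n} {C : ℝ} (hC : 0 ≤ C)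
    (h : ∀ φ : EuclideanSpace ℝ (Fin n) → ℂ, ContDiff ℝ ∞ φ → HasCompactSupport φ →
      ‖∫ x, w x * φ x‖ ≤ C * (eLpNorm φ 2 volume).toReal) : ‖w‖ ≤ C := by
  have key : ∀ v : L2 n, ‖⟪v, w⟫_ℂ‖ ≤ C * ‖v‖ := by
    intro v
    have hd := Lp.dense_hasCompactSupport_contDiff (E := EuclideanSpace ℝ (Fin n)) (F := ℂ)
      (μ := volume) (p := 2) (by simp)
    refine hd.induction (P := fun v : L2 n => ‖⟪v, w⟫_ℂ‖ ≤ C * ‖v‖) ?_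
      (isClosed_le (by fun_prop) (by fun_prop)) v
    rintro v ⟨g, hvg, hgc, hgs⟩
    have h1 := h (fun x => conj (g x)) (Complex.conjCLE.contDiff.comp hgs)
      (hgc.comp_left (g := fun z : ℂ => conj z) (map_zero _))
    have h2 : ∫ x, w x * conj (g x) = ⟪v, w⟫_ℂ := by
      rw [L2.inner_def]
      refine integral_congr_ae ?_
      filter_upwards [hvg] with x hx
      rw [hx]
      simp
    have h3 : (eLpNorm (fun x => conj (g x)) 2 volume).toReal = ‖v‖ := by
      rw [Lp.norm_def]
      congr 1
      refine eLpNorm_congr_norm_ae ?_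
      filter_upwards [hvg] with x hx
      rw [hx]; simp
    rwa [h2, h3] at h1
  rcases eq_or_lt_of_le (norm_nonneg w) with h0 | h0
  · rwa [← h0]
  · have := key w
    rw [inner_self_eq_norm_sq_to_K] at this
    simp at this
    nlinarith

/-- Expanding `h` in the standard basis reduces this to the defining identity of the weak gradient
and Cauchy–Schwarz. -/
lemma HasWeakGradient.norm_integral_mul_fderiv_le {u : L2 n} {g : Fin n → L2 n}
    (hg : HasWeakGradient u g) {φ : EuclideanSpace ℝ (Fin n) → ℂ} (hφ : ContDiff ℝ ∞ φ)
    (hc : HasCompactSupport φ) (h : EuclideanSpace ℝ (Fin n)) :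
    ‖∫ x, u x * fderiv ℝ φ x h‖ ≤
      (∑ i, ‖g i‖) * (eLpNorm φ 2 volume).toReal * ‖h‖ := by
  have hint : ∀ i, Integrable
      fun x => u x * fderiv ℝ φ x (EuclideanSpace.single i 1) := fun i =>
    integrable_L2_mul u ((hφ.continuous_fderiv (by simp)).clm_apply continuous_const)
      (hc.fderiv_apply ℝ _)
  have hh : h = ∑ i, h i • EuclideanSpace.single i (1 : ℝ) := by
    ext j
    simp [Finset.sum_apply, Pi.single_apply]
  have e : ∫ x, u x * fderiv ℝ φ x h = ∑ i, (h i : ℂ) * -∫ x, g i x * φ x := by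
    simp_rw [← hg φ hφ hc, ← integral_const_mul]
    rw [← integral_finsetSum _ fun i _ => (hint i).const_mul _]
    refine integral_congr_ae (Eventually.of_forall fun x => ?_)
    conv_lhs => rw [hh]
    simp only [map_sum, map_smul, Finset.mul_sum, Complex.real_smul]
    exact Finset.sum_congr rfl fun i _ => by ring
  rw [e, Finset.sum_mul, Finset.sum_mul]
  refine (norm_sum_le _ _).trans (Finset.sum_le_sum fun i _ => ?_)
  rw [norm_mul, norm_neg, mul_comm]
  have h1 : ‖(h i : ℂ)‖ ≤ ‖h‖ := by
    rw [Complex.norm_real]; exact PiLp.norm_apply_le h i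
  exact mul_le_mul (norm_integral_mul_le _ (hφ.continuous.memLp_of_hasCompactSupport hc)) h1
    (norm_nonneg _) (by positivity)

/-- The pairing of `u` with the translates of a test function is Lipschitz in the translation. -/
lemma HasWeakGradient.norm_integral_translate_sub_le {u : L2 n} {g : Fin n → L2 n}
    (hg : HasWeakGradient u g) {φ : EuclideanSpace ℝ (Fin n) → ℂ} (hφ : ContDiff ℝ ∞ φ)
    (hc : HasCompactSupport φ) (h : EuclideanSpace ℝ (Fin n)) :
    ‖(∫ x, u x * φ (x - h)) - ∫ x, u x * φ x‖ ≤
      (∑ i, ‖g i‖) * (eLpNorm φ 2 volume).toReal * ‖h‖ := by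
  -- With this reflection the pairing of `u` with `φ (· - y)` is a convolution, hence differentiable
  -- in `y`; a uniform derivative bound and the mean value inequality finish.
  set ψ : EuclideanSpace ℝ (Fin n) → ℂ := fun x => φ (-x) with hψ
  have hψs : ContDiff ℝ ∞ ψ := hφ.comp contDiff_neg
  have hψc : HasCompactSupport ψ := hc.comp_homeomorph (Homeomorph.neg _)
  have hloc : LocallyIntegrable (u : EuclideanSpace ℝ (Fin n) → ℂ) volume :=
    (Lp.memLp u).locallyIntegrable one_le_two
  have hder := fun y => hψc.hasFDerivAt_convolution_right (ContinuousLinearMap.mul ℝ ℂ) hloc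
    (hψs.of_le (by simp)) y
  have hconv : ∀ y, convolution (u : EuclideanSpace ℝ (Fin n) → ℂ) ψ (ContinuousLinearMap.mul ℝ ℂ)
      volume y = ∫ x, u x * φ (x - y) := fun y => by
    simp [convolution_def, hψ]
  have hbound : ∀ y, ‖convolution (u : EuclideanSpace ℝ (Fin n) → ℂ) (fderiv ℝ ψ)
      (ContinuousLinearMap.precompR _ (ContinuousLinearMap.mul ℝ ℂ)) volume y‖ ≤
      (∑ i, ‖g i‖) * (eLpNorm φ 2 volume).toReal := by
    intro y
    refine ContinuousLinearMap.opNorm_le_bound _ (by positivity) fun v => ?_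
    rw [convolution_precompR_apply _ hloc (hψc.fderiv ℝ) (hψs.continuous_fderiv (by simp))]
    set χ : EuclideanSpace ℝ (Fin n) → ℂ := fun x => φ (x - y) with hχ
    have hχs : ContDiff ℝ ∞ χ := hφ.comp (contDiff_id.sub contDiff_const)
    have hχc : HasCompactSupport χ := hc.comp_homeomorph (Homeomorph.subRight y)
    have hχn : eLpNorm χ 2 volume = eLpNorm φ 2 volume :=
      eLpNorm_comp_measurePreserving hφ.continuous.aestronglyMeasurable
        (measurePreserving_sub_right volume y)
    have hd : ∀ x, fderiv ℝ ψ (y - x) v = - fderiv ℝ χ x v := by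
      intro x
      have h1 : HasFDerivAt φ (fderiv ℝ φ (x - y)) (x - y) :=
        ((hφ.differentiable (by simp)) _).hasFDerivAt
      have h2 : fderiv ℝ χ x = fderiv ℝ φ (x - y) := fderiv_comp_sub y
      have h3 : fderiv ℝ ψ (y - x) = - fderiv ℝ φ (x - y) := by
        have h4 : HasFDerivAt φ (fderiv ℝ φ (x - y)) (-(y - x)) := by rwa [neg_sub]
        have h5 := h4.comp (y - x) (hasFDerivAt_id (𝕜 := ℝ) (y - x)).neg
        rw [show ψ = φ ∘ Neg.neg from rfl, h5.fderiv]
        ext; simp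
      rw [h2, h3]; rfl
    have e : convolution (u : EuclideanSpace ℝ (Fin n) → ℂ) (fun a => fderiv ℝ ψ a v)
        (ContinuousLinearMap.mul ℝ ℂ) volume y = - ∫ x, u x * fderiv ℝ χ x v := by
      rw [convolution_def, ← integral_neg]
      simp [hd]
    rw [e, norm_neg, ← hχn]
    exact hg.norm_integral_mul_fderiv_le hχs hχc v
  have := Convex.norm_image_sub_le_of_norm_hasFDerivWithin_le (𝕜 := ℝ) (s := Set.univ)
    (fun y _ => (hder y).hasFDerivWithinAt) (fun y _ => hbound y) convex_univ
    (Set.mem_univ 0) (Set.mem_univ h)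
  simpa [hconv] using this

/-- The translation estimate `‖u(· + h) - u‖ ≤ ‖∇u‖ |h|` for weakly differentiable `u`. -/
lemma HasWeakGradient.eLpNorm_translate_sub_le {u : L2 n} {g : Fin n → L2 n}
    (hg : HasWeakGradient u g) (h : EuclideanSpace ℝ (Fin n)) :
    eLpNorm (fun x => u (x + h) - u x) 2 volume ≤ ENNReal.ofReal ((∑ i, ‖g i‖) * ‖h‖) := by
  have htr : MemLp (fun x => u (x + h)) 2 volume :=
    (Lp.memLp u).comp_measurePreserving (measurePreserving_add_right volume h)
  have hw : MemLp (fun x => u (x + h) - u x) 2 volume := htr.sub (Lp.memLp u)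
  have hle : ‖hw.toLp‖ ≤ (∑ i, ‖g i‖) * ‖h‖ := by
    refine norm_le_of_forall_testFunction (by positivity) fun φ hφ hc => ?_
    have hφ2 : MemLp φ 2 volume := hφ.continuous.memLp_of_hasCompactSupport hc
    have e : ∫ x, (hw.toLp : L2 n) x * φ x = (∫ x, u x * φ (x - h)) - ∫ x, u x * φ x := by
      have e1 : ∫ x, u x * φ (x - h) = ∫ x, u (x + h) * φ x := by
        rw [← integral_add_right_eq_self _ h]
        simp
      have i1 : Integrable fun x => u (x + h) * φ x := htr.integrable_mul hφ2
      have i2 : Integrable fun x => u x * φ x := (Lp.memLp u).integrable_mul hφ2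
      rw [e1, ← integral_sub i1 i2]
      refine integral_congr_ae ?_
      filter_upwards [hw.coeFn_toLp] with x hx
      rw [hx, sub_mul]
    rw [e, mul_right_comm]
    exact hg.norm_integral_translate_sub_le hφ hc h
  rw [Lp.norm_toLp] at hle
  exact (ENNReal.le_ofReal_iff_toReal_le hw.eLpNorm_ne_top (by positivity)).2 hle

lemma HasWeakGradient.lintegral_translate_sub_le {u : L2 n} {g : Fin n → L2 n}
    (hg : HasWeakGradient u g) (h : EuclideanSpace ℝ (Fin n)) :
    ∫⁻ x, ‖u (x + h) - u x‖ₑ ^ 2 ≤ ENNReal.ofReal ((∑ i, ‖g i‖) * ‖h‖) ^ 2 := by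
  have h1 := hg.eLpNorm_translate_sub_le h
  have h2 : eLpNorm (fun x => u (x + h) - u x) 2 volume ^ 2 =
      ∫⁻ x, ‖u (x + h) - u x‖ₑ ^ 2 := by
    simpa using eLpNorm_nnreal_pow_eq_lintegral (f := fun x => u (x + h) - u x) (p := 2)
      (μ := volume) (by norm_num)
  rw [← h2]
  gcongr

end Translation

/-! ### Approximation by functions which are constant on small cubes -/

section Cells

variable {n : ℕ}

/-- The half-open cube of side `ε` with index `k`. -/
def cell (ε : ℝ) (k : Fin n → ℤ) : Set (EuclideanSpace ℝ (Fin n)) :=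
  {x | ∀ i, x i ∈ Set.Ico (ε * k i) (ε * (k i + 1))}

lemma cell_eq_preimage (ε : ℝ) (k : Fin n → ℤ) :
    cell ε k = (MeasurableEquiv.toLp 2 (Fin n → ℝ)).symm ⁻¹'
      (Set.univ.pi fun i => Set.Ico (ε * k i) (ε * (k i + 1))) := by
  ext x; simp [cell]

lemma measurableSet_cell (ε : ℝ) (k : Fin n → ℤ) : MeasurableSet (cell ε k) := by
  rw [cell_eq_preimage]
  exact (MeasurableEquiv.measurable _) (MeasurableSet.univ_pi fun i => measurableSet_Ico)

lemma volume_cell (ε : ℝ) (k : Fin n → ℤ) : volume (cell ε k) = ENNReal.ofReal ε ^ n := by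
  rw [cell_eq_preimage, (EuclideanSpace.volume_preserving_symm_measurableEquiv_toLp
    (Fin n)).measure_preimage_equiv, Real.volume_pi_Ico]
  simp [mul_add]

lemma mem_cell_iff {ε : ℝ} (hε : 0 < ε) {k : Fin n → ℤ} {x : EuclideanSpace ℝ (Fin n)} :
    x ∈ cell ε k ↔ k = fun i => ⌊x i / ε⌋ := by
  have h : ∀ i, x i ∈ Set.Ico (ε * k i) (ε * (k i + 1)) ↔ k i = ⌊x i / ε⌋ := fun i => by
    rw [eq_comm, Int.floor_eq_iff, le_div_iff₀ hε, div_lt_iff₀ hε, Set.mem_Ico, mul_comm ε,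
      mul_comm ε]
  simp only [cell, Set.mem_ofPred_eq, h, funext_iff]

lemma pairwise_disjoint_cell {ε : ℝ} (hε : 0 < ε) :
    Pairwise (Function.onFun Disjoint fun k : Fin n → ℤ => cell ε k) := fun _ _ hkl =>
  Set.disjoint_left.2 fun _ hk hl =>
    hkl (((mem_cell_iff hε).1 hk).trans ((mem_cell_iff hε).1 hl).symm)

lemma norm_sub_le_of_mem_cell {ε : ℝ} {k : Fin n → ℤ}
    {x y : EuclideanSpace ℝ (Fin n)} (hx : x ∈ cell ε k) (hy : y ∈ cell ε k) :
    ‖x - y‖ ≤ n * ε := by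
  have hxy : x - y = ∑ i, (x - y) i • EuclideanSpace.single i (1 : ℝ) := by
    ext j
    simp [Finset.sum_apply, Pi.single_apply]
  rw [hxy]
  refine (norm_sum_le _ _).trans ?_
  have : ∀ i ∈ Finset.univ, ‖(x - y) i • EuclideanSpace.single i (1 : ℝ)‖ ≤ ε := fun i _ => by
    have h1 := hx i
    have h2 := hy i
    rw [Set.mem_Ico] at h1 h2
    simp only [norm_smul, PiLp.norm_single, norm_one, mul_one, PiLp.sub_apply,
      Real.norm_eq_abs, abs_le]
    constructor <;> linarith
  simpa using Finset.sum_le_sum this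

/-- The finite set of indices of the cubes which may meet the ball of radius `r`. -/
def cellIndices (n : ℕ) (ε r : ℝ) : Finset (Fin n → ℤ) :=
  Finset.Icc (fun _ => ⌊-r / ε⌋) fun _ => ⌊r / ε⌋

lemma closedBall_subset_iUnion_cell {ε : ℝ} (hε : 0 < ε) (r : ℝ) :
    Metric.closedBall (0 : EuclideanSpace ℝ (Fin n)) r ⊆
      ⋃ k ∈ cellIndices n ε r, cell ε k := by
  intro x hx
  refine Set.mem_iUnion₂.2 ⟨fun i => ⌊x i / ε⌋, ?_, (mem_cell_iff hε).2 rfl⟩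
  have hxi : ∀ i, |x i| ≤ r := fun i =>
    (PiLp.norm_apply_le x i).trans (by simpa using hx)
  refine Finset.mem_Icc.2 ⟨fun i => ?_, fun i => ?_⟩
  · exact Int.floor_le_floor (by gcongr; exact (abs_le.1 (hxi i)).1)
  · exact Int.floor_le_floor (by gcongr; exact (abs_le.1 (hxi i)).2)

/-- On small cubes a weakly differentiable function is close, in the mean, to one of its values. -/
lemma HasWeakGradient.exists_sum_lintegral_cell_le {u : L2 n} {g : Fin n → L2 n}
    (hg : HasWeakGradient u g) {ε : ℝ} (hε : 0 < ε) (J : Finset (Fin n → ℤ)) :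
    ∃ y : (Fin n → ℤ) → EuclideanSpace ℝ (Fin n),
      ∑ k ∈ J, ∫⁻ x in cell ε k, ‖u x - u (y k)‖ₑ ^ 2 ≤
        ENNReal.ofReal (n : ℝ) ^ n * volume (Metric.ball (0 : EuclideanSpace ℝ (Fin n)) 1) *
          ENNReal.ofReal ((∑ i, ‖g i‖) * (n * ε)) ^ 2 := by
  have hum : Measurable (u : EuclideanSpace ℝ (Fin n) → ℂ) := (Lp.stronglyMeasurable u).measurable
  set q : ENNReal := ENNReal.ofReal ε ^ n with hq
  have hq0 : q ≠ 0 := pow_ne_zero _ (by simpa using hε)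
  have hqt : q ≠ ⊤ := ENNReal.pow_ne_top ENNReal.ofReal_ne_top
  set B : Set (EuclideanSpace ℝ (Fin n)) := Metric.closedBall 0 (n * ε) with hB
  have hvB : volume B = ENNReal.ofReal (n : ℝ) ^ n * q * volume (Metric.ball
      (0 : EuclideanSpace ℝ (Fin n)) 1) := by
    rw [hB, Measure.addHaar_closedBall _ _ (by positivity), finrank_euclideanSpace_fin, mul_pow,
      ENNReal.ofReal_mul (by positivity), ENNReal.ofReal_pow (by positivity),
      ENNReal.ofReal_pow hε.le]
  have hm2 : Measurable fun p : EuclideanSpace ℝ (Fin n) × EuclideanSpace ℝ (Fin n) =>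
      ‖u p.2 - u p.1‖ₑ ^ 2 := by fun_prop
  have hm3 : Measurable fun p : EuclideanSpace ℝ (Fin n) × EuclideanSpace ℝ (Fin n) =>
      ‖u (p.1 + p.2) - u p.1‖ₑ ^ 2 := by fun_prop
  -- Some sample point does no worse than the average over the cube, which makes a double integral
  -- of differences available.
  have hex : ∀ k, ∃ y ∈ cell ε k, ∫⁻ x in cell ε k, ‖u x - u y‖ₑ ^ 2 ≤
      ⨍⁻ y in cell ε k, ∫⁻ x in cell ε k, ‖u x - u y‖ₑ ^ 2 ∂volume ∂volume := fun k =>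
    exists_le_setLAverage (by rwa [volume_cell]) (by rwa [volume_cell])
      (hm2.lintegral_prod_right' (ν := volume.restrict (cell ε k))).aemeasurable
  choose y _ hy using hex
  refine ⟨y, ?_⟩
  have hin : ∀ k, ∀ y ∈ cell ε k, ∫⁻ x in cell ε k, ‖u x - u y‖ₑ ^ 2 ≤
      ∫⁻ h in B, ‖u (y + h) - u y‖ₑ ^ 2 := by
    intro k y hy
    have hsub : cell ε k ⊆ (fun x => x - y) ⁻¹' B := fun x hx => by
      simpa [hB] using norm_sub_le_of_mem_cell hx hy
    refine (lintegral_mono_set hsub).trans (le_of_eq ?_)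
    have := (measurePreserving_sub_right volume y).setLIntegral_comp_preimage
      (s := B) Metric.isClosed_closedBall.measurableSet
      (f := fun h => ‖u (y + h) - u y‖ₑ ^ 2) (by fun_prop)
    rw [← this]
    simp
  calc ∑ k ∈ J, ∫⁻ x in cell ε k, ‖u x - u (y k)‖ₑ ^ 2
      ≤ ∑ k ∈ J, q⁻¹ * ∫⁻ y in cell ε k, ∫⁻ h in B, ‖u (y + h) - u y‖ₑ ^ 2 := by
        refine Finset.sum_le_sum fun k _ => (hy k).trans ?_
        rw [setLAverage_eq, volume_cell, ENNReal.div_eq_inv_mul]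
        gcongr 1
        exact setLIntegral_mono' (measurableSet_cell ε k) (hin k)
    _ = q⁻¹ * ∫⁻ y in ⋃ k ∈ J, cell ε k, ∫⁻ h in B, ‖u (y + h) - u y‖ₑ ^ 2 := by
        rw [← Finset.mul_sum, lintegral_biUnion_finset
          (fun k _ l _ hkl => pairwise_disjoint_cell hε hkl) fun k _ => measurableSet_cell ε k]
    _ ≤ q⁻¹ * ∫⁻ y, ∫⁻ h in B, ‖u (y + h) - u y‖ₑ ^ 2 := by
        gcongr 1
        exact setLIntegral_le_lintegral _ _
    -- After the swap the translation estimate applies for each fixed `h`. The volume of `B` carries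
    -- a factor `q = ε ^ n` that cancels `q⁻¹`, leaving a constant independent of `ε`.
    _ = q⁻¹ * ∫⁻ h in B, ∫⁻ y, ‖u (y + h) - u y‖ₑ ^ 2 := by
        rw [lintegral_lintegral_swap hm3.aemeasurable]
    _ ≤ q⁻¹ * ∫⁻ _ in B, ENNReal.ofReal ((∑ i, ‖g i‖) * (n * ε)) ^ 2 := by
        gcongr 1
        refine setLIntegral_mono' Metric.isClosed_closedBall.measurableSet fun h hh => ?_
        refine (hg.lintegral_translate_sub_le h).trans ?_
        have : ‖h‖ ≤ n * ε := by simpa [hB] using hh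
        gcongr
    _ = _ := by
        rw [setLIntegral_const, hvB]
        calc _ = (q⁻¹ * q) * (ENNReal.ofReal (n : ℝ) ^ n * volume (Metric.ball
              (0 : EuclideanSpace ℝ (Fin n)) 1) *
              ENNReal.ofReal ((∑ i, ‖g i‖) * (n * ε)) ^ 2) := by ring
          _ = _ := by rw [ENNReal.inv_mul_cancel hq0 hqt, one_mul]

/-- The indicator function of the part of a cube in a ball, as an element of `L²`. -/
def cellIndicator (ε r : ℝ) (k : Fin n → ℤ) : L2 n :=
  indicatorConstLp 2 ((measurableSet_cell ε k).inter
    (Metric.isClosed_closedBall (x := (0 : EuclideanSpace ℝ (Fin n))) (ε := r)).measurableSet)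
    ((measure_mono Set.inter_subset_right).trans_lt measure_closedBall_lt_top).ne (1 : ℂ)

/-- The finite dimensional space of functions in `L²` which are supported in a ball and constant on
each of the cubes of side `ε`. -/
def cellSpace (n : ℕ) (ε r : ℝ) : Submodule ℂ (L2 n) :=
  Submodule.span ℂ (cellIndicator ε r '' (cellIndices n ε r : Set (Fin n → ℤ)))

instance (ε r : ℝ) : FiniteDimensional ℂ (cellSpace n ε r) :=
  FiniteDimensional.span_of_finite ℂ ((cellIndices n ε r).finite_toSet.image _)

/-- The approximant takes the sampled value `u (y k)` on each cube, cut off to the ball; the two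
error terms are oscillation on cubes and the tail of `u`. -/
lemma HasWeakGradient.exists_mem_cellSpace {u : L2 n} {g : Fin n → L2 n}
    (hg : HasWeakGradient u g) {ε : ℝ} (hε : 0 < ε) (r : ℝ) :
    ∃ v ∈ cellSpace n ε r, ∫⁻ x, ‖u x - v x‖ₑ ^ 2 ≤
      ENNReal.ofReal (n : ℝ) ^ n * volume (Metric.ball (0 : EuclideanSpace ℝ (Fin n)) 1) *
          ENNReal.ofReal ((∑ i, ‖g i‖) * (n * ε)) ^ 2 +
        ∫⁻ x in (Metric.closedBall (0 : EuclideanSpace ℝ (Fin n)) r)ᶜ, ‖u x‖ₑ ^ 2 := by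
  set B : Set (EuclideanSpace ℝ (Fin n)) := Metric.closedBall 0 r with hB
  have hBm : MeasurableSet B := Metric.isClosed_closedBall.measurableSet
  set J := cellIndices n ε r
  obtain ⟨y, hy⟩ := hg.exists_sum_lintegral_cell_le hε J
  refine ⟨∑ k ∈ J, u (y k) • cellIndicator ε r k, Submodule.sum_mem _ fun k hk =>
    Submodule.smul_mem _ _ (Submodule.subset_span ⟨k, hk, rfl⟩), ?_⟩
  set v : L2 n := ∑ k ∈ J, u (y k) • cellIndicator ε r k with hv
  have hvae : ∀ᵐ x ∂volume, v x =
      ∑ k ∈ J, u (y k) * (cell ε k ∩ B).indicator (fun _ => (1 : ℂ)) x := by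
    have h1 : ∀ᵐ x ∂volume, v x = ∑ k ∈ J, (u (y k) • cellIndicator ε r k : L2 n) x := by
      filter_upwards [Lp.coeFn_finsetSum J fun k => u (y k) • cellIndicator ε r k] with x hx
      rw [hv, hx, Finset.sum_apply]
    have h2 : ∀ᵐ x ∂volume, ∀ k : Fin n → ℤ, (u (y k) • cellIndicator ε r k : L2 n) x =
        u (y k) * (cell ε k ∩ B).indicator (fun _ => (1 : ℂ)) x := by
      rw [ae_all_iff]
      intro k
      filter_upwards [Lp.coeFn_smul (u (y k)) (cellIndicator ε r k),
        (indicatorConstLp_coeFn : (cellIndicator ε r k : L2 n) =ᵐ[volume] _)] with x h3 h4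
      rw [h3, Pi.smul_apply, smul_eq_mul]
      exact congrArg _ h4
    filter_upwards [h1, h2] with x h1 h2
    rw [h1]
    exact Finset.sum_congr rfl fun k _ => h2 k
  have hvcell : ∀ᵐ x ∂volume, ∀ k ∈ J, x ∈ cell ε k ∩ B → v x = u (y k) := by
    filter_upwards [hvae] with x hx k hk hxk
    rw [hx, Finset.sum_eq_single_of_mem k hk, Set.indicator_of_mem hxk, mul_one]
    intro l _ hlk
    rw [Set.indicator_of_notMem, mul_zero]
    exact fun hxl => Set.disjoint_left.1 (pairwise_disjoint_cell hε hlk) hxl.1 hxk.1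
  have hvout : ∀ᵐ x ∂volume, x ∈ Bᶜ → ‖u x - v x‖ₑ ^ 2 = ‖u x‖ₑ ^ 2 := by
    filter_upwards [hvae] with x hx hxB
    rw [hx, Finset.sum_eq_zero, sub_zero]
    intro k _
    rw [Set.indicator_of_notMem, mul_zero]
    exact fun h => hxB h.2
  rw [← lintegral_add_compl _ hBm]
  refine add_le_add (le_trans ?_ hy) (setLIntegral_congr_fun_ae hBm.compl hvout).le
  have hBsub : B = ⋃ k ∈ J, cell ε k ∩ B := by
    rw [← Set.iUnion₂_inter]
    exact (Set.inter_eq_right.2 (closedBall_subset_iUnion_cell hε r)).symm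
  have hmeas : ∀ k, MeasurableSet (cell ε k ∩ B) := fun k => (measurableSet_cell ε k).inter hBm
  conv_lhs => rw [hBsub]
  rw [lintegral_biUnion_finset (fun k _ l _ hkl => (pairwise_disjoint_cell hε hkl).mono
    Set.inter_subset_left Set.inter_subset_left) fun k _ => hmeas k]
  refine Finset.sum_le_sum fun k hk => ?_
  calc ∫⁻ x in cell ε k ∩ B, ‖u x - v x‖ₑ ^ 2
      = ∫⁻ x in cell ε k ∩ B, ‖u x - u (y k)‖ₑ ^ 2 := by
        refine setLIntegral_congr_fun_ae (hmeas k) ?_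
        filter_upwards [hvcell] with x hx hxk
        rw [hx k hk hxk]
    _ ≤ _ := lintegral_mono_set Set.inter_subset_left

end Cells

/-! ### Schrödinger operators have compact resolvent -/

section SchrodingerOperator

variable {n : ℕ}

lemma enorm_sq_eq_lintegral (u : L2 n) : ‖u‖ₑ ^ 2 = ∫⁻ x, ‖u x‖ₑ ^ 2 := by
  rw [Lp.enorm_def]
  simpa using eLpNorm_nnreal_pow_eq_lintegral (f := u) (p := 2) (μ := volume) (by norm_num)

lemma mulOp_coeFn {V : EuclideanSpace ℝ (Fin n) → ℂ} (u : (mulOp V).domain) :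
    (mulOp V u : EuclideanSpace ℝ (Fin n) → ℂ) =ᵐ[volume] fun x => V x * (u : L2 n) x :=
  MemLp.coeFn_toLp (mem_mulDomain.1 u.2)

/-- A ball in the form domain of `-Δ + W`. -/
def formBall (W : EuclideanSpace ℝ (Fin n) → ℝ) (C : ℝ) : Set (L2 n) :=
  {u | ‖u‖ ≤ C ∧ (∃ hu : u ∈ (sqrtOp W).domain, ‖sqrtOp W ⟨u, hu⟩‖ ≤ C) ∧
    ∃ g, HasWeakGradient u g ∧ ∑ i, ‖g i‖ ≤ C}

/-- Chebyshev's argument: `1 ≤ W / M` outside the ball. -/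
lemma lintegral_compl_closedBall_le {W : EuclideanSpace ℝ (Fin n) → ℝ} {M r : ℝ} (hM : 0 < M)
    (hr : ∀ x, r < ‖x‖ → M ≤ W x) (u : (sqrtOp W).domain) :
    ∫⁻ x in (Metric.closedBall (0 : EuclideanSpace ℝ (Fin n)) r)ᶜ, ‖(u : L2 n) x‖ₑ ^ 2 ≤
      (ENNReal.ofReal M)⁻¹ * ‖sqrtOp W u‖ₑ ^ 2 := by
  have hM0 : ENNReal.ofReal M ≠ 0 := by simpa using hM
  rw [enorm_sq_eq_lintegral, ← lintegral_const_mul' _ _ (ENNReal.inv_ne_top.2 hM0)]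
  refine le_trans (setLIntegral_mono_ae' Metric.isClosed_closedBall.measurableSet.compl ?_)
    (setLIntegral_le_lintegral _ _)
  filter_upwards [mulOp_coeFn u] with x hx hxB
  have hWx : M ≤ W x := hr x (by simpa using hxB)
  have h1 : ‖(√(W x) : ℂ)‖ₑ ^ 2 = ENNReal.ofReal (W x) := by
    rw [← ofReal_norm, Complex.norm_real, Real.norm_of_nonneg (Real.sqrt_nonneg _),
      ← ENNReal.ofReal_pow (Real.sqrt_nonneg _), Real.sq_sqrt (hM.le.trans hWx)]
  have hx' : (sqrtOp W u : L2 n) x = (√(W x) : ℂ) * (u : L2 n) x := hx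
  rw [hx', enorm_mul, mul_pow, h1, ← mul_assoc]
  refine le_mul_of_one_le_left (by positivity) ?_
  calc (1 : ENNReal) = (ENNReal.ofReal M)⁻¹ * ENNReal.ofReal M :=
        (ENNReal.inv_mul_cancel hM0 ENNReal.ofReal_ne_top).symm
    _ ≤ _ := by gcongr

/-- Balls in the form domain of `-Δ + W` are totally bounded in `L²` if `W → ∞` at infinity. -/
theorem totallyBounded_formBall {W : EuclideanSpace ℝ (Fin n) → ℝ}
    (hlim : Tendsto W (Bornology.cobounded (EuclideanSpace ℝ (Fin n))) atTop) (C : ℝ) :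
    TotallyBounded (formBall W C) := by
  refine totallyBounded_of_finiteDimensional_approx (fun u hu => hu.1) fun δ hδ => ?_
  set K : ENNReal := ENNReal.ofReal (n : ℝ) ^ n *
    volume (Metric.ball (0 : EuclideanSpace ℝ (Fin n)) 1) with hK
  have hKt : K ≠ ⊤ := ENNReal.mul_ne_top (ENNReal.pow_ne_top ENNReal.ofReal_ne_top)
    measure_ball_lt_top.ne
  -- Half of the squared error `δ ^ 2` goes to the oscillation, through `ε`, and half to the tail,
  -- through `M` and `r`.
  obtain ⟨ε, hεle, hε⟩ : ∃ ε : ℝ, K.toReal * (C * (n * ε)) ^ 2 < δ ^ 2 / 2 ∧ 0 < ε := by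
    have hcont : Tendsto (fun ε : ℝ => K.toReal * (C * (n * ε)) ^ 2) (𝓝[>] 0) (𝓝 0) := by
      have : Continuous fun ε : ℝ => K.toReal * (C * (n * ε)) ^ 2 := by fun_prop
      simpa using (this.tendsto 0).mono_left nhdsWithin_le_nhds
    exact ((hcont.eventually_lt_const (by positivity)).and self_mem_nhdsWithin).exists
  obtain ⟨M, hM, hMle⟩ : ∃ M : ℝ, 0 < M ∧ M⁻¹ * C ^ 2 ≤ δ ^ 2 / 2 := by
    refine ⟨2 * (C ^ 2 + 1) / δ ^ 2, by positivity, ?_⟩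
    rw [inv_div, div_mul_eq_mul_div, div_le_div_iff₀ (by positivity) (by positivity)]
    nlinarith [sq_nonneg C, sq_nonneg δ]
  obtain ⟨r, hr⟩ : ∃ r : ℝ, ∀ x, r < ‖x‖ → M ≤ W x := by
    have h1 := hlim.eventually_ge_atTop M
    rw [← comap_norm_atTop, eventually_comap] at h1
    obtain ⟨r, hr⟩ := eventually_atTop.1 h1
    exact ⟨r, fun x hx => hr _ hx.le x rfl⟩
  refine ⟨cellSpace n ε r, inferInstance, fun u hu => ?_⟩
  obtain ⟨huC, ⟨hud, hsC⟩, g, hg, hgC⟩ := hu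
  have hC : 0 ≤ C := (norm_nonneg u).trans huC
  obtain ⟨v, hv, hle⟩ := hg.exists_mem_cellSpace hε r
  refine ⟨v, hv, ?_⟩
  have h1 : ‖u - v‖ₑ ^ 2 = ∫⁻ x, ‖u x - v x‖ₑ ^ 2 := by
    rw [enorm_sq_eq_lintegral]
    refine lintegral_congr_ae ?_
    filter_upwards [Lp.coeFn_sub u v] with x hx
    rw [hx, Pi.sub_apply]
  have h2 : K * ENNReal.ofReal ((∑ i, ‖g i‖) * (n * ε)) ^ 2 ≤ ENNReal.ofReal (δ ^ 2 / 2) := by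
    have : (∑ i, ‖g i‖) * (n * ε) ≤ C * (n * ε) := by gcongr
    rw [← ENNReal.ofReal_toReal hKt, ← ENNReal.ofReal_pow (by positivity),
      ← ENNReal.ofReal_mul (by positivity)]
    refine ENNReal.ofReal_le_ofReal (le_trans ?_ hεle.le)
    gcongr
  have h3 : ∫⁻ x in (Metric.closedBall (0 : EuclideanSpace ℝ (Fin n)) r)ᶜ, ‖u x‖ₑ ^ 2 ≤
      ENNReal.ofReal (δ ^ 2 / 2) := by
    refine (lintegral_compl_closedBall_le hM hr ⟨u, hud⟩).trans ?_
    rw [← ofReal_norm, ← ENNReal.ofReal_inv_of_pos hM, ← ENNReal.ofReal_pow (norm_nonneg _),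
      ← ENNReal.ofReal_mul (by positivity)]
    refine ENNReal.ofReal_le_ofReal (le_trans ?_ hMle)
    gcongr
  have h4 : ‖u - v‖ₑ ^ 2 ≤ ENNReal.ofReal (δ ^ 2) := by
    rw [h1]
    refine hle.trans ((add_le_add h2 h3).trans ?_)
    rw [← ENNReal.ofReal_add (by positivity) (by positivity), add_halves]
  rw [← ofReal_norm, ← ENNReal.ofReal_pow (norm_nonneg _),
    ENNReal.ofReal_le_ofReal_iff (by positivity)] at h4
  exact (sq_le_sq₀ (norm_nonneg _) hδ.le).1 h4

variable {W : EuclideanSpace ℝ (Fin n) → ℝ}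

/-- A densely defined operator `-Δ + W` is given by its form. -/
lemma realSchrodingerOp_mem_formGraph (hd : Dense ((realSchrodingerOp W).domain : Set (L2 n)))
    (u : (realSchrodingerOp W).domain) : ((u : L2 n), realSchrodingerOp W u) ∈ formGraph W := by
  -- `toLinearPMap` reproduces the graph only if it is single valued; this holds because the form
  -- domain contains the dense operator domain.
  refine Submodule.mem_graph_toLinearPMap (formGraph_single_valued (hd.mono ?_)) u
  rintro _ ⟨p, ⟨hp, g, hg, -⟩, rfl⟩
  exact ⟨hp, g, hg⟩

/-- The energy identity `∫ |∇u|² + ∫ W |u|² = ⟪u, (-Δ + W) u⟫`. -/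
lemma exists_energy_eq (hd : Dense ((realSchrodingerOp W).domain : Set (L2 n)))
    (u : (realSchrodingerOp W).domain) :
    ∃ (hu : (u : L2 n) ∈ (sqrtOp W).domain) (g : Fin n → L2 n), HasWeakGradient (u : L2 n) g ∧
      ∑ i, ‖g i‖ ^ 2 + ‖sqrtOp W ⟨u, hu⟩‖ ^ 2 =
        (⟪(u : L2 n), realSchrodingerOp W u⟫_ℂ).re := by
  obtain ⟨hu, g, hg, h⟩ := realSchrodingerOp_mem_formGraph hd u
  refine ⟨hu, g, hg, ?_⟩
  rw [← h u hu g hg]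
  simp only [inner_self_eq_norm_sq_to_K, Complex.add_re, Complex.re_sum]
  norm_cast

/-- The integrand `I * b x * ‖u x‖ ^ 2` is purely imaginary. -/
lemma re_inner_mulOp_I_mul (b : EuclideanSpace ℝ (Fin n) → ℝ)
    (u : (mulOp fun x => Complex.I * (b x : ℂ)).domain) :
    (⟪(u : L2 n), mulOp (fun x => Complex.I * (b x : ℂ)) u⟫_ℂ).re = 0 := by
  have hint := L2.integrable_inner (𝕜 := ℂ) (u : L2 n) (mulOp (fun x => Complex.I * (b x : ℂ)) u)
  rw [L2.inner_def, ← RCLike.re_eq_complex_re, ← integral_re hint]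
  refine integral_eq_zero_of_ae ?_
  filter_upwards [mulOp_coeFn u] with x hx
  rw [hx]
  simp
  ring

/-- The resolvent of `-Δ + W` is compact if `W → ∞` at infinity. -/
theorem IsResolventAt.isCompactOperator_realSchrodingerOp
    (hlim : Tendsto W (Bornology.cobounded (EuclideanSpace ℝ (Fin n))) atTop)
    (hd : Dense ((realSchrodingerOp W).domain : Set (L2 n))) {z : ℂ} {R : L2 n →L[ℂ] L2 n}
    (hR : IsResolventAt (realSchrodingerOp W) z R) : IsCompactOperator R := by
  set D : ℝ := ‖R‖ * (‖z‖ * ‖R‖ + 1) with hD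
  have hD0 : 0 ≤ D := by positivity
  set C : ℝ := ‖R‖ + (n + 1) * √D with hC
  -- `D` bounds the energy `re ⟪R f, z R f - f⟫`, so `√D` bounds each gradient component and the
  -- potential term; `C` dominates all three form-ball bounds.
  have hsub : R '' Metric.closedBall 0 1 ⊆ formBall W C := by
    rintro _ ⟨f, hf, rfl⟩
    have hf1 : ‖f‖ ≤ 1 := by simpa using hf
    have hRf : ‖R f‖ ≤ ‖R‖ := by simpa using R.le_opNorm_of_le hf1
    obtain ⟨hu, g, hg, he⟩ := exists_energy_eq hd ⟨R f, hR.mem_domain f⟩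
    rw [hR.map_apply] at he
    have hen : ∑ i, ‖g i‖ ^ 2 + ‖sqrtOp W ⟨R f, hu⟩‖ ^ 2 ≤ D := by
      rw [he]
      refine (Complex.re_le_norm _).trans ((norm_inner_le_norm _ _).trans ?_)
      have : ‖z • R f - f‖ ≤ ‖z‖ * ‖R‖ + 1 := by
        refine (norm_sub_le _ _).trans (add_le_add ?_ hf1)
        rw [norm_smul]; gcongr
      exact mul_le_mul hRf this (norm_nonneg _) (norm_nonneg _)
    have hsum : 0 ≤ ∑ i, ‖g i‖ ^ 2 := Finset.sum_nonneg fun i _ => sq_nonneg _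
    have hsD : ‖sqrtOp W ⟨R f, hu⟩‖ ≤ √D := Real.le_sqrt_of_sq_le (by linarith)
    have hgD : ∀ i, ‖g i‖ ≤ √D := fun i => Real.le_sqrt_of_sq_le <| by
      have := Finset.single_le_sum (f := fun i => ‖g i‖ ^ 2) (fun i _ => sq_nonneg _)
        (Finset.mem_univ i)
      linarith [sq_nonneg ‖sqrtOp W ⟨R f, hu⟩‖]
    have hgs : ∑ i, ‖g i‖ ≤ n * √D := by
      simpa using Finset.sum_le_sum fun i (_ : i ∈ Finset.univ) => hgD i
    have h0 := Real.sqrt_nonneg D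
    have h1 : 0 ≤ (n : ℝ) * √D := by positivity
    have h2 := norm_nonneg R
    refine ⟨?_, ⟨hu, ?_⟩, g, hg, ?_⟩ <;> rw [hC] <;> linarith
  refine (isCompactOperator_iff_isCompact_closure_image_closedBall (R : L2 n →ₗ[ℂ] L2 n)
    one_pos).2 ?_
  exact ((totallyBounded_formBall hlim C).subset hsub).closure.isCompact_of_isClosed
    isClosed_closure

end SchrodingerOperator

end Schrodinger

theorem mainTheorem1 (n : ℕ) (V : EuclideanSpace ℝ (Fin n) → ℂ)
    (hV : AEMeasurable V volume)
    (hpos : ∀ x, 0 ≤ (V x).re)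
    (hlim : Tendsto (fun x => (V x).re) (Bornology.cobounded (EuclideanSpace ℝ (Fin n))) atTop)
    (hrel : Schrodinger.IsRelativelyCompact
      (Schrodinger.mulOp fun x => Complex.I * ((V x).im : ℂ))
      (Schrodinger.realSchrodingerOp fun x => (V x).re)) :
    Schrodinger.HasPurelyDiscreteSpectrum (Schrodinger.schrodingerOp V) := by
  obtain ⟨hd, hTA, z, R, hR, hA⟩ := hrel
  have hc := hR.isCompactOperator_realSchrodingerOp hlim hd
  obtain ⟨S, hS, hSR⟩ := hR.exists_isResolventAt_add hc hTA hA (w := -1) fun u hu => by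
    obtain ⟨hs, g, -, he⟩ := Schrodinger.exists_energy_eq hd u
    have h1 := Schrodinger.re_inner_mulOp_I_mul (fun x => (V x).im) ⟨u, hTA u.2⟩
    have h2 := congrArg (fun v => (⟪(u : Schrodinger.L2 n), v⟫_ℂ).re) hu
    simp only [inner_add_right, Complex.add_re, neg_smul, one_smul, inner_neg_right,
      Complex.neg_re] at h2
    have h5 : (⟪(u : Schrodinger.L2 n), u⟫_ℂ).re = ‖(u : Schrodinger.L2 n)‖ ^ 2 :=
      inner_self_eq_norm_sq (𝕜 := ℂ) (u : Schrodinger.L2 n)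
    rw [h1, ← he, h5] at h2
    have h3 : 0 ≤ ∑ i, ‖g i‖ ^ 2 := Finset.sum_nonneg fun i _ => sq_nonneg _
    -- The real part of the eigenvalue equation at `-1` says that the nonnegative energy equals
    -- `-‖u‖ ^ 2`.
    have h4 : ‖(u : Schrodinger.L2 n)‖ ^ 2 ≤ 0 := by
      linarith [sq_nonneg ‖Schrodinger.sqrtOp (fun x => (V x).re) ⟨u, hs⟩‖]
    simpa using h4
  exact hSR.hasPurelyDiscreteSpectrum hS
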